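/- Let $d\ge 1$, let $\mathsf B\subset\mathbb R^d$ be the closed Euclidean unit ball, and let $w^*\in\mathsf B$ be a hidden point. In each round $t=1,\dots,T$ a learner queries a point $p_t\in\mathsf B$, and a (strong) separation oracle answers with an adversarially chosen unit vector $v_t$ (which may depend on $p_t$ and on the past) such that $\langle w^*,v_t\rangle\ge\langle p_t,v_t\rangle$. The regret is $\sum_{t=1}^T\langle w^*-p_t,v_t\rangle$. The knowledge sets are $K_1=\mathsf B$ and $K_{t+1}=K_t\cap\{w:\langle w-p_t,v_t\rangle\ge 0\}$. A John ellipsoid of $K\subseteq\mathbb R^d$ is an ellipsoid $E=A^{-1}(q+\mathsf B)$, with $A:\mathbb R^d\to\mathbb R^d$ linear and invertible and $q\in\mathbb R^d$, such that $q+\mathsf B\subseteq A(K)\subseteq q+d\,\mathsf B$; its center is $A^{-1}q$. Theorem. The cutting-plane algorithm which in each round $t$ queries the center $p_t$ of a John ellipsoid of $K_t$ is well defined (in every run, each knowledge set $K_t$ has a John ellipsoid, and the center of any such ellipsoid lies in $\mathsf B$), and it incurs regret $\exp(O(d\log d))$, independently of $T$. That is, there is an absolute constant $C>0$ such that for all $d\ge1$,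 all $T\ge0$, all $w^*\in\mathsf B$, all choices of the John ellipsoids and all answers of the separation oracle, $$\sum_{t=1}^T\langle w^*-p_t,v_t\rangle\;\le\;\exp\bigl(C\,d\log\max(d,2)\bigr).$$ -/

import Mathlib

open Metric

/-- The Euclidean space `ℝ^d` (with the Euclidean norm and inner product). -/
abbrev Euc (d : ℕ) : Type := EuclideanSpace ℝ (Fin d)

/-- `E` is a John ellipsoid of `K ⊆ ℝ^d`, with center `c`: for some invertible linear map `A` and
some point `q`, one has `q + B ⊆ A(K) ⊆ q + d B` (with `B` the closed unit ball),
`E = A⁻¹(q + B)`, and `c = A⁻¹ q`. -/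
def IsJohnEllipsoid {d : ℕ} (K E : Set (Euc d)) (c : Euc d) : Prop :=
  ∃ (A : Euc d ≃ₗ[ℝ] Euc d) (q : Euc d),
    closedBall q 1 ⊆ A '' K ∧ A '' K ⊆ closedBall q (d : ℝ) ∧
    E = A.symm '' closedBall q 1 ∧ c = A.symm q

/-- The knowledge set after `t` rounds, for queries `p 0, p 1, …` answered by the directions
`v 0, v 1, …`. It starts as the closed unit ball, and each round cuts it with the halfspace
returned by the separation oracle. -/
def knowledgeSet {d : ℕ} (p v : ℕ → Euc d) : ℕ → Set (Euc d)
  | 0 => closedBall 0 1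
  | t + 1 => knowledgeSet p v t ∩ {w | 0 ≤ inner ℝ (w - p t) (v t)}

/-- `T` rounds (numbered `0, …, T - 1`) of the cutting-plane algorithm that always queries the
center of a John ellipsoid of the current knowledge set, played against a strong separation oracle
with hidden point `w`. Nothing but the displayed conditions restricts the oracle's answers `v t`,
so they may depend on everything, including the query `p t`. Only the values of `p` and `v` at
`t < T` matter. -/
structure IsJohnRun {d : ℕ} (T : ℕ) (w : Euc d) (p v : ℕ → Euc d) : Prop where
  hidden_mem : w ∈ closedBall (0 : Euc d) 1
  query : ∀ t < T, ∃ E, IsJohnEllipsoid (knowledgeSet p v t) E (p t)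
  norm_answer : ∀ t < T, ‖v t‖ = 1
  answer : ∀ t < T, inner ℝ (p t) (v t) ≤ inner ℝ w (v t)

/-- Total regret of the first `T` rounds. -/
noncomputable def cuttingPlaneRegret {d : ℕ} (T : ℕ) (w : Euc d) (p v : ℕ → Euc d) : ℝ :=
  ∑ t ∈ Finset.range T, inner ℝ (w - p t) (v t)

/-!
# Regret of the John ellipsoid cutting-plane algorithm

John's theorem is proved by stretching a maximal inscribed ellipsoid towards a far point of the
body. For the regret, a query with regret at least `ε` shrinks the volume of the
`ε / (4 d)`-neighborhood of the knowledge set by the factor `1 - (2 d) ^ (-d) / 2`. This bounds the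
number of such queries by `O(ε ^ (-1/2))` with a constant `exp (O(d log d))`, which is summable.
-/

/-! ### John's theorem. -/

section John

variable {V : Type*} [NormedAddCommGroup V] [InnerProductSpace ℝ V]

/-! A large regret forces a deep cut. With center `p` and hidden point `w`, John's sandwich puts `(w
- p) / d` in the centered ellipsoid, and symmetry puts its negative there too, on the discarded side
at depth at least `ε / d`. Half of a half-size copy of the ellipsoid, pushed towards that point, is
lost. Raw volume has no positive lower bound, so the potential is the volume of the
`δ`-neighborhood, which always contains a `δ`-ball around `w`; with `δ = ε / (4 d)` the lost piece
stays outside the thickened new set (`measureReal_add_le_of_cut`).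

The potential stays between multiples of `δ ^ d` and `(1 + δ) ^ d`, so the number of `ε`-large
regrets is at most `exp (O(d log d))` times `log (1 / δ)`, up to lower order terms. Bounding the
logarithm by a square root makes the `k`-th largest regret `O(1 / k ^ 2)`, whence a sum independent
of `T`.

The algorithm never gets stuck: a cut through the center leaves half an ellipsoid, so the next set
has interior and John's theorem applies. -/

/-- The linear map that scales by `a` along the unit vector `e` and by `b` on its orthogonal
complement. -/
noncomputable def axialStretch (e : V) (a b : ℝ) : V →ₗ[ℝ] V :=
  b • LinearMap.transvection ((a / b - 1) • (innerₗ V e)) e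

lemma axialStretch_apply (e : V) (a : ℝ) {b : ℝ} (hb : b ≠ 0) (y : V) :
    axialStretch e a b y = b • y + ((a - b) * inner ℝ e y) • e := by
  simp only [axialStretch, LinearMap.smul_apply, LinearMap.transvection.apply, innerₗ_apply_apply,
    smul_eq_mul, smul_add, smul_smul]
  congr 2
  field_simp

/-- Squaring removes the square root: `b` will be chosen through `b ^ 2`. -/
lemma det_axialStretch_sq [FiniteDimensional ℝ V] {e : V} (he : ‖e‖ = 1) (a : ℝ) {b : ℝ}
    (hb : b ≠ 0) (hd : 1 ≤ Module.finrank ℝ V) :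
    (LinearMap.det (axialStretch e a b)) ^ 2 = a ^ 2 * (b ^ 2) ^ (Module.finrank ℝ V - 1) := by
  obtain ⟨n, hn⟩ := Nat.exists_eq_add_of_le' hd
  simp only [axialStretch, LinearMap.det_smul, LinearMap.transvection.det, LinearMap.smul_apply,
    innerₗ_apply_apply, real_inner_self_eq_norm_sq, he, hn, Nat.add_sub_cancel, smul_eq_mul]
  field_simp
  ring

/-- A closed convex set that contains the unit ball and the point `r • e` contains an ellipsoid
stretched in the direction of `e`. -/
lemma axialStretch_mem {K : Set V} (hK : Convex ℝ K) (hKc : IsClosed K)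
    (hB : closedBall 0 1 ⊆ K) {e : V} (he : ‖e‖ = 1) {r : ℝ} (hr : 1 < r) (hrK : r • e ∈ K)
    {s b : ℝ} (hs : 0 ≤ s) (hsr : s ≤ r) (hb : 0 < b) (hbs : b ^ 2 = 1 - 2 * s / (r - 1))
    {y : V} (hy : y ∈ closedBall (0 : V) 1) [CompleteSpace V] :
    s • e + axialStretch e (1 + s) b y ∈ K := by
  by_contra hmem
  obtain ⟨f, α, hf, hα⟩ := geometric_hahn_banach_closed_point hK hKc hmem
  obtain ⟨u, rfl⟩ := (InnerProductSpace.toDual ℝ V).surjective f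
  simp only [InnerProductSpace.toDual_apply_apply] at hf hα
  have hn : ‖u‖ ≤ α := by
    rcases eq_or_ne u 0 with rfl | hu
    · simpa using (hf 0 (hB (by simp))).le
    · have h := hf (‖u‖⁻¹ • u) (hB (by
        simp [norm_smul, inv_mul_cancel₀ (norm_ne_zero_iff.2 hu)]))
      rw [inner_smul_right, real_inner_self_eq_norm_sq, pow_two,
        inv_mul_cancel_left₀ (norm_ne_zero_iff.2 hu)] at h
      exact h.le
  have hre := (hf _ hrK).le
  rw [inner_smul_right] at hre
  set x := inner ℝ u e with hx
  have hxn : |x| ≤ ‖u‖ := by simpa [he] using abs_real_inner_le_norm u e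
  set M := b • u + ((1 + s - b) * x) • e with hM
  have hMy : inner ℝ u (s • e + axialStretch e (1 + s) b y) = s * x + inner ℝ M y := by
    rw [axialStretch_apply e _ hb.ne', hM]
    simp only [inner_add_right, inner_add_left, inner_smul_right, inner_smul_left, ← hx]
    simp only [conj_trivial]
    ring
  have hMn : ‖M‖ ^ 2 = b ^ 2 * ‖u‖ ^ 2 + ((1 + s) ^ 2 - b ^ 2) * x ^ 2 := by
    rw [hM, norm_add_sq_real, norm_smul, norm_smul, he, inner_smul_left, inner_smul_right, ← hx]
    simp only [conj_trivial, Real.norm_eq_abs, mul_pow, sq_abs, abs_mul]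
    ring
  have hMy' : inner ℝ M y ≤ ‖M‖ := by
    refine (real_inner_le_norm M y).trans (mul_le_of_le_one_right (norm_nonneg _) ?_)
    simpa using hy
  have hx1 := neg_le_of_abs_le hxn
  have hr1 : 0 < r - 1 := by linarith
  have hb' : (1 - b ^ 2) * (r - 1) = 2 * s := by rw [hbs]; field_simp; ring
  have hb1 : 0 ≤ 1 - b ^ 2 := by rw [hbs, sub_sub_cancel]; positivity
  -- The right side is the support function at `u` of the convex hull of the unit ball and `r • e`;
  -- the left side is that of the stretched ellipsoid.
  suffices h : s * x + ‖M‖ ≤ max ‖u‖ (r * x) by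
    have := max_le hn hre
    linarith
  rcases le_total (r * x) ‖u‖ with h | h
  · rw [max_eq_left h]
    have h0 : 0 ≤ ‖u‖ - s * x := by
      rcases le_total x 0 with hx0 | hx0
      · nlinarith [norm_nonneg u]
      · nlinarith
    have h1 : ‖M‖ ^ 2 ≤ (‖u‖ - s * x) ^ 2 := by
      rw [hMn]
      -- The choice of `b ^ 2` makes the difference of the two squares factor in this way.
      have h2 : 0 ≤ (‖u‖ + x) * ((1 - b ^ 2) * (‖u‖ - r * x)) :=
        mul_nonneg (by linarith) (mul_nonneg hb1 (by linarith))
      have : (‖u‖ + x) * ((1 - b ^ 2) * (‖u‖ - r * x)) =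
          (‖u‖ - s * x) ^ 2 - (b ^ 2 * ‖u‖ ^ 2 + ((1 + s) ^ 2 - b ^ 2) * x ^ 2) := by
        linear_combination (-(‖u‖ + x) * x) * hb'
      linarith
    linarith [(abs_le_of_sq_le_sq' h1 h0).2]
  · rw [max_eq_right h]
    have hx0 : 0 ≤ x := nonneg_of_mul_nonneg_right ((norm_nonneg u).trans h) (by linarith)
    have h1 : ‖M‖ ^ 2 ≤ ((r - s) * x) ^ 2 := by
      rw [hMn]
      have h2 : ‖u‖ ^ 2 ≤ (r * x) ^ 2 := pow_le_pow_left₀ (norm_nonneg _) h 2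
      have h3 := mul_le_mul_of_nonneg_left h2 (sq_nonneg b)
      have : b ^ 2 * (r * x) ^ 2 + ((1 + s) ^ 2 - b ^ 2) * x ^ 2 = ((r - s) * x) ^ 2 := by
        linear_combination (-(r + 1) * x ^ 2) * hb'
      linarith
    linarith [(abs_le_of_sq_le_sq' h1 (mul_nonneg (by linarith) hx0)).2]

/-- If a closed convex set contains the unit ball and a point of norm greater than the dimension,
it contains an ellipsoid of larger volume than the unit ball. -/
lemma exists_one_lt_det_of_finrank_lt_norm [FiniteDimensional ℝ V] {K : Set V} (hK : Convex ℝ K)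
    (hKc : IsClosed K) (hB : closedBall 0 1 ⊆ K) (hd : 1 ≤ Module.finrank ℝ V) {x : V} (hx : x ∈ K)
    (hxn : (Module.finrank ℝ V : ℝ) < ‖x‖) :
    ∃ (M : V →ₗ[ℝ] V) (c : V), 1 < |LinearMap.det M| ∧
      ∀ y ∈ closedBall (0 : V) 1, c + M y ∈ K := by
  have : CompleteSpace V := FiniteDimensional.complete ℝ V
  obtain ⟨n, hn⟩ := Nat.exists_eq_add_of_le' hd
  set r := ‖x‖ with hr
  have hd' : (1 : ℝ) ≤ Module.finrank ℝ V := by exact_mod_cast hd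
  have hr0 : 0 < r := by linarith
  set e := r⁻¹ • x with he
  have hen : ‖e‖ = 1 := by rw [he, norm_smul, norm_inv, norm_norm, inv_mul_cancel₀ hr0.ne']
  have hre : r • e ∈ K := by rwa [he, smul_inv_smul₀ hr0.ne']
  have hnr : (n : ℝ) + 1 < r := by rw [hn] at hxn; exact_mod_cast hxn
  have hn0 : (0 : ℝ) ≤ n := n.cast_nonneg
  -- To first order in `s` the squared determinant is `1 + 2 s (1 - n / (r - 1))`. This `s` gives `n
  -- / (r - 1) ≤ 1 - 4 s`, enough to absorb the higher order terms.
  set s := (r - (n + 1)) / (4 * r) with hs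
  have hs0 : 0 < s := by rw [hs]; apply div_pos <;> linarith
  have hs4 : 4 * r * s = r - (n + 1) := by rw [hs]; field_simp
  have hs1 : s ≤ 1 / 4 := by nlinarith
  have hr1 : 0 < r - 1 := by linarith
  have hsr : s ≤ (r - 1) / 4 := by nlinarith
  have hq0 : 2 * s / (r - 1) ≤ 1 / 2 := by
    rw [div_le_iff₀ hr1]; linarith
  have hbp : 0 < 1 - 2 * s / (r - 1) := by linarith
  have hb : 0 < √(1 - 2 * s / (r - 1)) := Real.sqrt_pos.2 hbp
  have hb2 : √(1 - 2 * s / (r - 1)) ^ 2 = 1 - 2 * s / (r - 1) := Real.sq_sqrt hbp.le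
  refine ⟨axialStretch e (1 + s) √(1 - 2 * s / (r - 1)), s • e, ?_, fun y hy =>
    axialStretch_mem hK hKc hB hen (by linarith) hre hs0.le (by linarith) hb hb2 hy⟩
  rw [← one_lt_sq_iff_one_lt_abs, det_axialStretch_sq hen _ hb.ne' hd, hb2, hn,
    Nat.add_sub_cancel]
  have hbern := one_add_mul_le_pow (a := -(2 * s / (r - 1))) (by linarith) n
  have h1 : (1 + s) ^ 2 * (1 + n * -(2 * s / (r - 1))) ≤
      (1 + s) ^ 2 * (1 - 2 * s / (r - 1)) ^ n := by
    exact mul_le_mul_of_nonneg_left (by rwa [sub_eq_add_neg]) (sq_nonneg _)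
  refine lt_of_lt_of_le ?_ h1
  set θ := (n : ℝ) / (r - 1) with hθ
  have hθ' : 1 + (n : ℝ) * -(2 * s / (r - 1)) = 1 - 2 * s * θ := by rw [hθ]; ring
  have hθ0 : 0 ≤ θ := div_nonneg hn0 hr1.le
  have hθ1 : θ ≤ 1 - 4 * s := by
    rw [hθ, div_le_iff₀ hr1]; nlinarith
  rw [hθ']
  nlinarith [mul_pos hs0 hs0, mul_nonneg hs0.le hθ0, mul_nonneg (mul_nonneg hs0.le hs0.le) hθ0,
    mul_nonneg hs0.le (sub_nonneg.2 hθ1), mul_nonneg (mul_nonneg hs0.le hs0.le) (sub_nonneg.2 hθ1),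
    mul_nonneg (mul_nonneg (mul_nonneg hs0.le hs0.le) hs0.le) (sub_nonneg.2 hθ1)]

/-- A convex body has an inscribed ellipsoid of maximal volume. -/
lemma exists_max_det_ellipsoid [FiniteDimensional ℝ V] {K : Set V} (hK : IsCompact K)
    (hint : (interior K).Nonempty) :
    ∃ (L : V →L[ℝ] V) (c : V), 0 < |L.det| ∧ (∀ y ∈ closedBall (0 : V) 1, c + L y ∈ K) ∧
      ∀ (L' : V →L[ℝ] V) (c' : V), (∀ y ∈ closedBall (0 : V) 1, c' + L' y ∈ K) →
        |L'.det| ≤ |L.det| := by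
  have : ProperSpace ((V →L[ℝ] V) × V) := FiniteDimensional.proper ℝ _
  set X : Set ((V →L[ℝ] V) × V) := {P | ∀ y ∈ closedBall (0 : V) 1, P.2 + P.1 y ∈ K} with hX
  have hXc : IsClosed X := by
    simp only [hX, Set.ofPred_forall]
    refine isClosed_biInter fun y _ => hK.isClosed.preimage ?_
    fun_prop
  obtain ⟨R, hR⟩ := hK.isBounded.exists_norm_le
  have hR0 : 0 ≤ R := by
    obtain ⟨z, hz⟩ := hint
    exact (norm_nonneg z).trans (hR z (interior_subset hz))
  have hXb : Bornology.IsBounded X := by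
    refine (isBounded_closedBall (x := (0 : (V →L[ℝ] V) × V)) (r := R + R)).subset ?_
    rintro ⟨L, c⟩ hP
    have hc : ‖c‖ ≤ R := hR _ (by simpa using hP 0 (by simp))
    rw [mem_closedBall_zero_iff, Prod.norm_def]
    refine max_le (ContinuousLinearMap.opNorm_le_of_unit_norm (by linarith) fun y hy => ?_)
      (by simpa using hc.trans (by linarith))
    have h1 := hR _ (hP y (by simp [hy]))
    have h2 := norm_sub_le (c + L y) c
    simp only [add_sub_cancel_left] at h2
    linarith
  obtain ⟨z, hz⟩ := hint
  obtain ⟨ε, hε, hzε⟩ := nhds_basis_closedBall.mem_iff.1 (mem_interior_iff_mem_nhds.1 hz)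
  have h0 : (ε • ContinuousLinearMap.id ℝ V, z) ∈ X := by
    intro y hy
    apply hzε
    simp only [mem_closedBall_zero_iff] at hy
    simpa [norm_smul, abs_of_pos hε] using mul_le_of_le_one_right hε.le hy
  obtain ⟨⟨L, c⟩, hLX, hmax⟩ := (isCompact_of_isClosed_isBounded hXc hXb).exists_isMaxOn ⟨_, h0⟩
    (f := fun P => |P.1.det|)
    (ContinuousLinearMap.continuous_det.comp continuous_fst).abs.continuousOn
  refine ⟨L, c, lt_of_lt_of_le ?_ (hmax h0), hLX, fun L' c' h => hmax (show (L', c') ∈ X from h)⟩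
  have : (ε • ContinuousLinearMap.id ℝ V).det = ε ^ Module.finrank ℝ V := by
    simp [ContinuousLinearMap.det]
  simp only [this]
  positivity

/-- **John's theorem**: a convex body contains an ellipsoid whose dilation about its center by the
dimension contains the body. -/
theorem exists_john_ellipsoid [FiniteDimensional ℝ V] {K : Set V} (hK : Convex ℝ K)
    (hKc : IsCompact K) (hint : (interior K).Nonempty) (hd : 1 ≤ Module.finrank ℝ V) :
    ∃ (L : V ≃ₗ[ℝ] V) (c : V), (∀ y ∈ closedBall (0 : V) 1, c + L y ∈ K) ∧
      ∀ x ∈ K, ‖L.symm (x - c)‖ ≤ Module.finrank ℝ V := by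
  obtain ⟨L, c, hL0, hLK, hmax⟩ := exists_max_det_ellipsoid hKc hint
  have hdet : IsUnit (LinearMap.det (L : V →ₗ[ℝ] V)) := isUnit_iff_ne_zero.2 (abs_pos.1 hL0)
  set L' := LinearMap.equivOfIsUnitDet hdet with hL'
  have hLL' : ∀ y, L' y = L y := fun y => LinearMap.equivOfIsUnitDet_apply hdet y
  refine ⟨L', c, fun y hy => by rw [hLL']; exact hLK y hy, fun x hx => ?_⟩
  by_contra! hxn
  have hcont : Continuous fun y => c + L y := by fun_prop
  -- In coordinates where the maximal ellipsoid is the unit ball, a point too far away would yield a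
  -- larger ellipsoid.
  have hconv : Convex ℝ ((fun y => c + L y) ⁻¹' K) :=
    (hK.translate_preimage_right c).linear_preimage (L : V →ₗ[ℝ] V)
  have hmem : L'.symm (x - c) ∈ (fun y => c + L y) ⁻¹' K := by
    simp [← hLL', hx]
  obtain ⟨M, c', hM, hMK⟩ := exists_one_lt_det_of_finrank_lt_norm hconv
    (hKc.isClosed.preimage hcont) hLK hd hmem hxn
  have h := hmax (L.comp (LinearMap.toContinuousLinearMap M)) (c + L c') fun y hy => by
    have := hMK y hy
    simpa [add_assoc] using this
  have hdetM : (L.comp (LinearMap.toContinuousLinearMap M)).det = L.det * LinearMap.det M := by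
    simp [ContinuousLinearMap.det]
  rw [hdetM, abs_mul] at h
  nlinarith

end John

/-! ### Volume removed by a deep cut. -/

section Cut

open MeasureTheory Pointwise

variable {V : Type*} [NormedAddCommGroup V] [InnerProductSpace ℝ V] [FiniteDimensional ℝ V]
  [MeasurableSpace V] [BorelSpace V] (μ : Measure V) [μ.IsAddHaarMeasure]

lemma measureReal_image_add_smul (a : V) {r : ℝ} (hr : 0 ≤ r) (s : Set V) :
    μ.real ((fun y => a + r • y) '' s) = r ^ Module.finrank ℝ V * μ.real s := by
  have : (fun y => a + r • y) '' s = (fun y => a + y) '' (r • s) := by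
    rw [← Set.image_smul, Set.image_image]
  rw [this, Set.image_add_left, measureReal_def, measure_preimage_add, Measure.addHaar_smul,
    ENNReal.toReal_mul, abs_of_nonneg (by positivity), ENNReal.toReal_ofReal (by positivity),
    measureReal_def]

/-- A halfspace through the center contains at least half of a symmetric body. -/
lemma measureReal_le_two_mul_inter_halfspace {G : Set V} (hG : IsCompact G)
    (hsymm : ∀ y ∈ G, -y ∈ G) (v : V) :
    μ.real G ≤ 2 * μ.real (G ∩ {y | inner ℝ y v ≤ 0}) := by
  set S := G ∩ {y | inner ℝ y v ≤ 0} with hS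
  have hfin : μ S ≠ ⊤ := ((measure_mono Set.inter_subset_left).trans_lt hG.measure_lt_top).ne
  have hsub : G ⊆ S ∪ -S := by
    intro y hy
    rcases le_total (inner ℝ y v) 0 with h | h
    · exact Or.inl ⟨hy, h⟩
    · exact Or.inr ⟨hsymm y hy, by simpa [inner_neg_left] using h⟩
  have hneg : μ.real (-S) = μ.real S := by simp [measureReal_def]
  have hfin' : μ (-S) ≠ ⊤ := by simpa using hfin
  calc μ.real G ≤ μ.real (S ∪ -S) := measureReal_mono hsub (measure_union_ne_top hfin hfin')
    _ ≤ μ.real S + μ.real (-S) := measureReal_union_le _ _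
    _ = 2 * μ.real S := by rw [hneg]; ring

/-- If `K` is sandwiched between the symmetric bodies `p + G` and `p + D G`, then cutting away a
halfspace that reaches deep enough into `p + G` removes a definite fraction of the volume. -/
lemma measureReal_add_le_of_cut {G K K' : Set V} (hG : IsCompact G) (hGc : Convex ℝ G)
    (hsymm : ∀ y ∈ G, -y ∈ G) {p v z : V} {δ D : ℝ} (hδ : 0 < δ) (hD : 0 < D) (hz : z ∈ G)
    (hzv : inner ℝ z v ≤ -(4 * δ)) (hGK : ∀ y ∈ G, p + y ∈ K)
    (hKG : K ⊆ (fun y => p + D • y) '' G) (hK'K : K' ⊆ K)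
    (hK' : ∀ x ∈ K', -δ ≤ inner ℝ (x - p) v) :
    μ.real K' + μ.real K / (2 * (2 * D) ^ Module.finrank ℝ V) ≤ μ.real K := by
  set d := Module.finrank ℝ V
  set H := G ∩ {y | inner ℝ y v ≤ 0} with hH
  -- Averaging `z` with the half of `G` where `v` is nonpositive gives depth at least `2 δ`, beyond
  -- the `δ` allowed in `K'`.
  set S := (fun y => (p + (1 / 2 : ℝ) • z) + (1 / 2 : ℝ) • y) '' H with hS
  have hGD : IsCompact ((fun y => p + D • y) '' G) := hG.image (by fun_prop)
  have hKfin : μ K ≠ ⊤ := ((measure_mono hKG).trans_lt hGD.measure_lt_top).ne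
  have hHc : IsCompact H := hG.inter_right (isClosed_le (by fun_prop) continuous_const)
  have hSm : MeasurableSet S := (hHc.image (by fun_prop)).isClosed.measurableSet
  have hSK : S ⊆ K := by
    rintro _ ⟨y, hy, rfl⟩
    have h := hGc hz hy.1 (by norm_num : (0 : ℝ) ≤ 1 / 2) (by norm_num : (0 : ℝ) ≤ 1 / 2)
      (by norm_num)
    simpa only [add_assoc] using hGK _ h
  have hdisj : Disjoint K' S := by
    rw [Set.disjoint_left]
    rintro _ hx ⟨y, hy, rfl⟩
    have h1 := hK' _ hx
    have h2 : inner ℝ y v ≤ 0 := hy.2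
    have h3 : p + (1 / 2 : ℝ) • z + (1 / 2 : ℝ) • y - p = (1 / 2 : ℝ) • z + (1 / 2 : ℝ) • y := by
      abel
    simp only [h3, inner_add_left, real_inner_smul_left] at h1
    linarith
  have hunion : μ.real K' + μ.real S ≤ μ.real K := by
    rw [← measureReal_union hdisj hSm
      (ne_top_of_le_ne_top hKfin (measure_mono hK'K))
      (ne_top_of_le_ne_top hKfin (measure_mono hSK))]
    exact measureReal_mono (Set.union_subset hK'K hSK) hKfin
  have hSv : μ.real S = (1 / 2) ^ d * μ.real H := measureReal_image_add_smul μ _ (by norm_num) H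
  have hKv : μ.real K ≤ D ^ d * μ.real G := by
    rw [← measureReal_image_add_smul μ p hD.le G]
    exact measureReal_mono hKG hGD.measure_lt_top.ne
  have hGH := measureReal_le_two_mul_inter_halfspace μ hG hsymm v
  have : μ.real K / (2 * (2 * D) ^ d) ≤ μ.real S := by
    rw [div_le_iff₀ (by positivity), hSv]
    calc μ.real K ≤ D ^ d * (2 * μ.real H) :=
          hKv.trans (mul_le_mul_of_nonneg_left hGH (by positivity))
      _ = (1 / 2) ^ d * μ.real H * (2 * (2 * D) ^ d) := by
          rw [mul_pow, one_div, inv_pow]; field_simp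
  linarith

end Cut

/-! ### From counting large terms to bounding the sum. -/

lemma sum_range_one_div_succ_sq_le (n : ℕ) :
    ∑ k ∈ Finset.range n, 1 / ((k : ℝ) + 1) ^ 2 ≤ 2 - 1 / (n : ℝ) := by
  induction n with
  | zero => simp
  | succ n ih =>
    rw [Finset.sum_range_succ]
    rcases n.eq_zero_or_pos with rfl | hn
    · norm_num
    · have hn' : (0 : ℝ) < n := by exact_mod_cast hn
      have : 1 / ((n : ℝ) + 1) ^ 2 ≤ 1 / n - 1 / ((n : ℝ) + 1) := by
        rw [div_sub_div _ _ hn'.ne' (by positivity), div_le_div_iff₀ (by positivity) (by positivity)]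
        nlinarith
      push_cast
      linarith

/-- If the number of terms that are at least `ε` is `O(ε ^ (-1/2))`, the sum is bounded. -/
lemma sum_le_of_card_sq_mul_le {ι : Type*} {Q : ℝ} (hQ : 0 ≤ Q) (r : ι → ℝ) (S : Finset ι)
    (h : ∀ t ∈ S, 0 < r t → ((S.filter (r t ≤ r ·)).card : ℝ) ^ 2 * r t ≤ Q) :
    ∑ t ∈ S, r t ≤ 2 * Q := by
  classical
  suffices h' : ∑ t ∈ S, r t ≤ Q * ∑ k ∈ Finset.range S.card, 1 / ((k : ℝ) + 1) ^ 2 by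
    have h1 := sum_range_one_div_succ_sq_le S.card
    have h2 : (0 : ℝ) ≤ 1 / S.card := by positivity
    nlinarith
  induction hn : S.card generalizing S with
  | zero => simp [Finset.card_eq_zero.1 hn]
  | succ n ih =>
    -- All `n + 1` terms are at least the smallest one, so that one is at most `Q / (n + 1) ^ 2`.
    obtain ⟨t, ht, hmin⟩ := S.exists_min_image r (Finset.card_pos.1 (by omega))
    have h1 := ih (S.erase t) (fun u hu hpos => by
      refine le_trans ?_ (h u (Finset.mem_of_mem_erase hu) hpos)
      gcongr
      exact Finset.erase_subset _ _) (by rw [Finset.card_erase_of_mem ht, hn]; rfl)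
    rw [← Finset.sum_erase_add S r ht, Finset.sum_range_succ, mul_add]
    refine add_le_add h1 ?_
    rcases le_or_gt (r t) 0 with h0 | h0
    · exact h0.trans (by positivity)
    · have h2 := h t ht h0
      rw [Finset.filter_true_of_mem hmin, hn] at h2
      rw [mul_one_div, le_div_iff₀ (by positivity)]
      push_cast at h2
      linarith

/-! ### Knowledge sets and well-definedness. -/

section KnowledgeSet

variable {d : ℕ} {p v : ℕ → Euc d}

lemma knowledgeSet_succ_subset (t : ℕ) : knowledgeSet p v (t + 1) ⊆ knowledgeSet p v t :=
  Set.inter_subset_left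

lemma knowledgeSet_subset_closedBall (t : ℕ) : knowledgeSet p v t ⊆ closedBall 0 1 := by
  induction t with
  | zero => exact subset_rfl
  | succ t ih => exact (knowledgeSet_succ_subset t).trans ih

lemma isClosed_knowledgeSet (t : ℕ) : IsClosed (knowledgeSet p v t) := by
  induction t with
  | zero => exact isClosed_closedBall
  | succ t ih => exact ih.inter (isClosed_le continuous_const (by fun_prop))

lemma isCompact_knowledgeSet (t : ℕ) : IsCompact (knowledgeSet p v t) :=
  (isCompact_closedBall 0 1).of_isClosed_subset (isClosed_knowledgeSet t)
    (knowledgeSet_subset_closedBall t)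

lemma convex_knowledgeSet (t : ℕ) : Convex ℝ (knowledgeSet p v t) := by
  induction t with
  | zero => exact convex_closedBall 0 1
  | succ t ih =>
    refine ih.inter fun x hx y hy a b ha hb hab => ?_
    change 0 ≤ inner ℝ (x - p t) (v t) at hx
    change 0 ≤ inner ℝ (y - p t) (v t) at hy
    change 0 ≤ inner ℝ (a • x + b • y - p t) (v t)
    have : a • x + b • y - p t = a • (x - p t) + b • (y - p t) := by
      rw [smul_sub, smul_sub, sub_add_sub_comm, ← add_smul, hab, one_smul]
    rw [this, inner_add_left, real_inner_smul_left, real_inner_smul_left]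
    positivity

lemma IsJohnEllipsoid.center_mem {K E : Set (Euc d)} {c : Euc d} (h : IsJohnEllipsoid K E c) :
    c ∈ K := by
  obtain ⟨A, q, h1, -, -, rfl⟩ := h
  obtain ⟨x, hx, hxq⟩ := h1 (mem_closedBall_self zero_le_one)
  rwa [← hxq, A.symm_apply_apply]

lemma exists_isJohnEllipsoid {K : Set (Euc d)} (hd : 1 ≤ d) (hK : Convex ℝ K) (hKc : IsCompact K)
    (hint : (interior K).Nonempty) : ∃ E c, IsJohnEllipsoid K E c := by
  obtain ⟨L, c, h1, h2⟩ := exists_john_ellipsoid hK hKc hint (by simpa using hd)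
  refine ⟨_, _, L.symm, L.symm c, ?_, ?_, rfl, rfl⟩
  · intro y hy
    refine ⟨L y, ?_, L.symm_apply_apply y⟩
    have := h1 (y - L.symm c) (by rwa [mem_closedBall_zero_iff, ← dist_eq_norm])
    simpa using this
  · rintro _ ⟨x, hx, rfl⟩
    rw [mem_closedBall, dist_eq_norm, ← map_sub]
    simpa using h2 x hx

lemma IsJohnEllipsoid.interior_inter_halfspace_nonempty {K E : Set (Euc d)} {c v : Euc d}
    (h : IsJohnEllipsoid K E c) (hv : v ≠ 0) :
    (interior (K ∩ {w | 0 ≤ inner ℝ (w - c) v})).Nonempty := by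
  obtain ⟨A, q, h1, -, -, rfl⟩ := h
  have hA : Continuous A := (A : Euc d →ₗ[ℝ] Euc d).continuous_of_finiteDimensional
  set U : Set (Euc d) := A ⁻¹' ball q 1 ∩ {w | 0 < inner ℝ (w - A.symm q) v} with hU
  have hUo : IsOpen U :=
    (isOpen_ball.preimage hA).inter (isOpen_lt continuous_const (by fun_prop))
  have hUK : U ⊆ K ∩ {w | 0 ≤ inner ℝ (w - A.symm q) v} := by
    rintro x ⟨hx, hx'⟩
    obtain ⟨y, hy, hyx⟩ := h1 (ball_subset_closedBall hx)
    obtain rfl := A.injective hyx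
    exact ⟨hy, le_of_lt (show 0 < inner ℝ (y - A.symm q) v from hx')⟩
  -- A step from the center along `v`, short enough that its image under `A` has norm below `1`.
  refine Set.Nonempty.mono (interior_maximal hUK hUo) ⟨A.symm q + (1 / (‖A v‖ + 1)) • v, ?_, ?_⟩
  · have h0 : 0 < ‖A v‖ + 1 := by positivity
    simp only [Set.mem_preimage, map_add, A.apply_symm_apply, map_smul, mem_ball, dist_eq_norm,
      add_sub_cancel_left, norm_smul, Real.norm_eq_abs, abs_of_pos (one_div_pos.2 h0)]
    rw [one_div_mul_eq_div, div_lt_one h0]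
    linarith
  · change 0 < inner ℝ (A.symm q + (1 / (‖A v‖ + 1)) • v - A.symm q) v
    rw [add_sub_cancel_left, real_inner_smul_left]
    have := real_inner_self_pos.2 hv
    positivity

variable {T : ℕ} {w : Euc d}

lemma IsJohnRun.mem_knowledgeSet (h : IsJohnRun T w p v) {t : ℕ} (ht : t ≤ T) :
    w ∈ knowledgeSet p v t := by
  induction t with
  | zero => exact h.hidden_mem
  | succ t ih =>
    refine ⟨ih (by omega), ?_⟩
    change 0 ≤ inner ℝ (w - p t) (v t)
    rw [inner_sub_left]
    exact sub_nonneg.2 (h.answer t ht)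

lemma IsJohnRun.interior_knowledgeSet_nonempty (h : IsJohnRun T w p v) :
    (interior (knowledgeSet p v T)).Nonempty := by
  cases T with
  | zero => exact ⟨0, by simp [knowledgeSet, interior_closedBall]⟩
  | succ t =>
    obtain ⟨E, hE⟩ := h.query t t.lt_succ_self
    exact hE.interior_inter_halfspace_nonempty (norm_ne_zero_iff.1 (by
      rw [h.norm_answer t t.lt_succ_self]; exact one_ne_zero))

/-! ### The volume potential and the regret bound. -/

open MeasureTheory Pointwise

/-- The volume of the `δ`-neighborhood of the knowledge set after `t` rounds. -/
noncomputable def thickenedVolume (p v : ℕ → Euc d) (δ : ℝ) (t : ℕ) : ℝ :=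
  volume.real (knowledgeSet p v t + closedBall 0 δ)

lemma thickenedVolume_succ_le (δ : ℝ) (t : ℕ) :
    thickenedVolume p v δ (t + 1) ≤ thickenedVolume p v δ t :=
  measureReal_mono (Set.add_subset_add_right (knowledgeSet_succ_subset t))
    ((isCompact_knowledgeSet t).add (isCompact_closedBall 0 δ)).measure_lt_top.ne

/-- A query with large regret shrinks the neighborhood of the knowledge set by a constant factor. -/
lemma thickenedVolume_succ_le_mul (hd : 1 ≤ d) {t : ℕ} {E : Set (Euc d)}
    (hE : IsJohnEllipsoid (knowledgeSet p v t) E (p t)) (hv : ‖v t‖ = 1)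
    (hw : w ∈ knowledgeSet p v t) {ε : ℝ} (hε : 0 < ε) (hr : ε ≤ inner ℝ (w - p t) (v t)) :
    thickenedVolume p v (ε / (4 * d)) (t + 1) ≤
      (1 - 1 / (2 * (2 * d) ^ d)) * thickenedVolume p v (ε / (4 * d)) t := by
  obtain ⟨A, q, h1, h2, -, hp⟩ := hE
  have hd0 : (1 : ℝ) ≤ d := by exact_mod_cast hd
  set δ := ε / (4 * d) with hδ
  have hδ0 : 0 < δ := by positivity
  have hA : Continuous A.symm := (A.symm : Euc d →ₗ[ℝ] Euc d).continuous_of_finiteDimensional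
  have hq : A (p t) = q := by rw [hp, A.apply_symm_apply]
  set E₀ : Set (Euc d) := A.symm '' closedBall 0 1 with hE₀
  have hsmall : ∀ x ∈ knowledgeSet p v t, (d : ℝ)⁻¹ • (x - p t) ∈ E₀ := by
    intro x hx
    refine ⟨(d : ℝ)⁻¹ • (A x - q), ?_, ?_⟩
    · have := h2 ⟨x, hx, rfl⟩
      rw [mem_closedBall, dist_eq_norm] at this
      rw [mem_closedBall_zero_iff, norm_smul, norm_inv, RCLike.norm_natCast,
        inv_mul_le_one₀ (by linarith)]
      exact this
    · rw [map_smul, map_sub, A.symm_apply_apply, hp]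
  have hE₀s : ∀ y ∈ E₀, -y ∈ E₀ := by
    rintro _ ⟨y, hy, rfl⟩
    exact ⟨-y, by simpa using hy, map_neg _ _⟩
  have hE₀K : ∀ y ∈ E₀, p t + y ∈ knowledgeSet p v t := by
    rintro _ ⟨y, hy, rfl⟩
    obtain ⟨x, hx, hxy⟩ := h1 (show q + y ∈ closedBall q 1 by simpa using hy)
    rwa [hp, ← map_add, ← hxy, A.symm_apply_apply]
  -- Reflecting the hidden point through the center gives the deep point on the discarded side.
  have hz : -((d : ℝ)⁻¹ • (w - p t)) ∈ E₀ := hE₀s _ (hsmall w hw)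
  have key := measureReal_add_le_of_cut (volume : Measure (Euc d)) (G := E₀ + closedBall 0 δ)
    (K := knowledgeSet p v t + closedBall 0 δ) (K' := knowledgeSet p v (t + 1) + closedBall 0 δ)
    (((isCompact_closedBall 0 1).image hA).add (isCompact_closedBall 0 δ))
    (((convex_closedBall 0 1).linear_image (A.symm : Euc d →ₗ[ℝ] Euc d)).add
      (convex_closedBall 0 δ)) ?_ (p := p t) (v := v t) (z := -((d : ℝ)⁻¹ • (w - p t)))
    hδ0 (by linarith : (0 : ℝ) < d) ?_ ?_ ?_ ?_
    (Set.add_subset_add_right (knowledgeSet_succ_subset t)) ?_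
  · rw [finrank_euclideanSpace_fin] at key
    unfold thickenedVolume
    rw [sub_mul, one_mul, one_div_mul_eq_div]
    linarith
  · rintro _ ⟨y, hy, b, hb, rfl⟩
    exact ⟨-y, hE₀s y hy, -b, by simpa using hb, (neg_add y b).symm⟩
  · exact ⟨_, hz, 0, by simpa using hδ0.le, add_zero _⟩
  · rw [inner_neg_left, real_inner_smul_left, neg_le_neg_iff, hδ]
    calc 4 * (ε / (4 * d)) = (d : ℝ)⁻¹ * ε := by field_simp
      _ ≤ _ := by gcongr
  · rintro _ ⟨y, hy, b, hb, rfl⟩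
    exact ⟨_, hE₀K y hy, b, hb, add_assoc _ _ _⟩
  · rintro _ ⟨x, hx, b, hb, rfl⟩
    refine ⟨(d : ℝ)⁻¹ • (x - p t) + (d : ℝ)⁻¹ • b, ⟨_, hsmall x hx, _, ?_, rfl⟩, ?_⟩
    · rw [mem_closedBall_zero_iff] at hb ⊢
      rw [norm_smul, norm_inv, RCLike.norm_natCast]
      exact (mul_le_of_le_one_left (norm_nonneg b) (inv_le_one_of_one_le₀ hd0)).trans hb
    · have : (d : ℝ) ≠ 0 := by positivity
      simp only [smul_add, smul_inv_smul₀ this]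
      abel
  · rintro _ ⟨x, hx, b, hb, rfl⟩
    have h3 : 0 ≤ inner ℝ (x - p t) (v t) := hx.2
    have h4 : x + b - p t = (x - p t) + b := by abel
    have h5 := neg_le_of_abs_le (abs_real_inner_le_norm b (v t))
    rw [hv, mul_one] at h5
    rw [mem_closedBall_zero_iff] at hb
    change -δ ≤ inner ℝ (x + b - p t) (v t)
    rw [h4, inner_add_left]
    linarith

lemma thickenedVolume_le_pow_mul (hd : 1 ≤ d) (h : IsJohnRun T w p v) {ε : ℝ} (hε : 0 < ε) {t : ℕ}
    (ht : t ≤ T) :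
    thickenedVolume p v (ε / (4 * d)) t ≤ (1 - 1 / (2 * (2 * d) ^ d)) ^
      ((Finset.range t).filter fun s => ε ≤ inner ℝ (w - p s) (v s)).card *
        thickenedVolume p v (ε / (4 * d)) 0 := by
  induction t with
  | zero => simp
  | succ t ih =>
    have ih := ih (by omega)
    rw [Finset.range_add_one, Finset.filter_insert]
    split_ifs with hr
    · rw [Finset.card_insert_of_notMem (by simp), pow_succ']
      obtain ⟨E, hE⟩ := h.query t ht
      refine (thickenedVolume_succ_le_mul hd hE (h.norm_answer t ht)
        (h.mem_knowledgeSet (by omega)) hε hr).trans ?_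
      rw [mul_assoc]
      refine mul_le_mul_of_nonneg_left ih (sub_nonneg.2 ?_)
      have hd0 : (1 : ℝ) ≤ d := by exact_mod_cast hd
      have : (1 : ℝ) ≤ (2 * d) ^ d := one_le_pow₀ (by linarith)
      rw [div_le_one (by positivity)]
      linarith
    · exact (thickenedVolume_succ_le _ t).trans ih

/-- Comparing the `δ`-ball around `w` with the initial ball of radius `1 + δ` limits how often the
potential can shrink by the factor `1 - η`. -/
lemma card_filter_regret_sq_mul_le (hd : 1 ≤ d) (h : IsJohnRun T w p v) {ε : ℝ} (hε : 0 < ε)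
    (hε2 : ε ≤ 2) :
    ((((Finset.range T).filter fun s => ε ≤ inner ℝ (w - p s) (v s)).card : ℝ)) ^ 2 * ε ≤
      96 * (d : ℝ) ^ 3 * (2 * d) ^ (2 * d) := by
  have hd0 : (1 : ℝ) ≤ d := by exact_mod_cast hd
  have hvol := thickenedVolume_le_pow_mul hd h hε le_rfl
  set N := ((Finset.range T).filter fun s => ε ≤ inner ℝ (w - p s) (v s)).card
  set δ := ε / (4 * d) with hδ
  set η : ℝ := 1 / (2 * (2 * d) ^ d) with hη
  have hη0 : 0 < η := by positivity
  have hδ0 : 0 < δ := by positivity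
  have hη1 : η ≤ 1 := by
    have : (1 : ℝ) ≤ (2 * d) ^ d := one_le_pow₀ (by linarith)
    rw [hη, div_le_one (by positivity)]
    linarith
  set β := volume.real (closedBall (0 : Euc d) 1) with hβ
  have hβ0 : 0 < β := ENNReal.toReal_pos (measure_closedBall_pos _ _ one_pos).ne'
    (isCompact_closedBall _ _).measure_lt_top.ne
  have hlow : δ ^ d * β ≤ thickenedVolume p v δ T := by
    have := Measure.addHaar_real_closedBall' (volume : Measure (Euc d)) w hδ0.le
    rw [finrank_euclideanSpace_fin] at this
    rw [← this]
    refine measureReal_mono (fun x hx => ⟨w, h.mem_knowledgeSet le_rfl, x - w, ?_, by simp⟩)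
      ((isCompact_knowledgeSet T).add (isCompact_closedBall 0 δ)).measure_lt_top.ne
    rwa [mem_closedBall_zero_iff, ← dist_eq_norm]
  have hup : thickenedVolume p v δ 0 ≤ (1 + δ) ^ d * β := by
    have := Measure.addHaar_real_closedBall' (volume : Measure (Euc d)) 0
      (by positivity : 0 ≤ 1 + δ)
    rw [finrank_euclideanSpace_fin] at this
    rw [← this]
    refine measureReal_mono ?_ (isCompact_closedBall _ _).measure_lt_top.ne
    rintro _ ⟨x, hx, b, hb, rfl⟩
    rw [knowledgeSet, mem_closedBall_zero_iff] at hx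
    rw [mem_closedBall_zero_iff] at hb ⊢
    exact (norm_add_le x b).trans (add_le_add hx hb)
  have hpow : (1 - η) ^ N ≤ Real.exp (-(η * N)) := by
    have := pow_le_pow_left₀ (sub_nonneg.2 hη1) (Real.one_sub_le_exp_neg η) N
    rwa [← Real.exp_nat_mul, show (N : ℝ) * -η = -(η * N) by ring] at this
  have h1 : δ ^ d ≤ Real.exp (-(η * N)) * (1 + δ) ^ d := by
    refine le_of_mul_le_mul_right ?_ hβ0
    calc δ ^ d * β ≤ (1 - η) ^ N * thickenedVolume p v δ 0 := hlow.trans hvol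
      _ ≤ Real.exp (-(η * N)) * ((1 + δ) ^ d * β) := by
        gcongr
        exact (measureReal_nonneg)
      _ = _ := by ring
  set y := (1 + δ) / δ with hy
  have hy0 : 0 < y := by positivity
  have h2 : Real.exp (η * N) ≤ y ^ d := by
    rw [hy, div_pow, le_div_iff₀ (by positivity)]
    calc Real.exp (η * N) * δ ^ d
        ≤ Real.exp (η * N) * (Real.exp (-(η * N)) * (1 + δ) ^ d) := by gcongr
      _ = (1 + δ) ^ d := by rw [← mul_assoc, ← Real.exp_add]; simp
  -- Here `y` is of order `d / ε`; any power of `y` below `1` in place of the square root would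
  -- still give a summable bound.
  have h3 : η * N ≤ d * (2 * √y) := by
    have h4 := (Real.le_log_iff_exp_le (by positivity)).2 h2
    rw [Real.log_pow] at h4
    refine h4.trans ?_
    have h5 : Real.log y ≤ 2 * √y := by
      have := Real.log_le_self (Real.sqrt_nonneg y)
      rw [Real.log_sqrt hy0.le] at this
      linarith
    gcongr
  have h6 : (η * N) ^ 2 ≤ 4 * d ^ 2 * y := by
    calc (η * N) ^ 2 ≤ (d * (2 * √y)) ^ 2 := by gcongr
      _ = 4 * d ^ 2 * √y ^ 2 := by ring
      _ = 4 * d ^ 2 * y := by rw [Real.sq_sqrt hy0.le]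
  have h7 : y * ε ≤ 6 * d := by
    have : y * ε = ε + 4 * d := by rw [hy, hδ]; field_simp; ring
    linarith
  have h8 : (N : ℝ) ^ 2 = (η * N) ^ 2 * (2 * (2 * d) ^ d) ^ 2 := by
    rw [hη]; field_simp
  calc (N : ℝ) ^ 2 * ε ≤ 4 * d ^ 2 * y * (2 * (2 * d) ^ d) ^ 2 * ε := by rw [h8]; gcongr
    _ = 16 * d ^ 2 * ((2 * d) ^ d) ^ 2 * (y * ε) := by ring
    _ ≤ 16 * d ^ 2 * ((2 * d) ^ d) ^ 2 * (6 * d) := by gcongr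
    _ = _ := by rw [← pow_mul, mul_comm d 2]; ring

lemma IsJohnRun.cuttingPlaneRegret_le (hd : 1 ≤ d) (h : IsJohnRun T w p v) :
    cuttingPlaneRegret T w p v ≤ 2 * (96 * (d : ℝ) ^ 3 * (2 * d) ^ (2 * d)) := by
  refine sum_le_of_card_sq_mul_le (by positivity) _ _ fun t ht hpos => ?_
  rw [Finset.mem_range] at ht
  refine card_filter_regret_sq_mul_le hd h hpos ?_
  obtain ⟨E, hE⟩ := h.query t ht
  have hp := knowledgeSet_subset_closedBall t hE.center_mem
  have hw := h.hidden_mem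
  rw [mem_closedBall_zero_iff] at hp hw
  calc inner ℝ (w - p t) (v t) ≤ ‖w - p t‖ * ‖v t‖ := real_inner_le_norm _ _
    _ ≤ 2 := by rw [h.norm_answer t ht]; linarith [norm_sub_le w (p t)]

end KnowledgeSet

/-- Each factor is a power of `m = max d 2`, with `192 ≤ 2 ^ 8 ≤ m ^ 8`; the exponents add up to `11
+ 4 d ≤ 15 d`. -/
lemma two_mul_regret_constant_le_exp {d : ℕ} (hd : 1 ≤ d) :
    2 * (96 * (d : ℝ) ^ 3 * (2 * d) ^ (2 * d)) ≤
      Real.exp (15 * d * Real.log (max (d : ℝ) 2)) := by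
  set m := max (d : ℝ) 2 with hm
  have hm2 : 2 ≤ m := le_max_right _ _
  have hdm : (d : ℝ) ≤ m := le_max_left _ _
  have hm0 : 0 < m := by linarith
  have hexp : Real.exp (15 * d * Real.log m) = m ^ (15 * d) := by
    rw [← Real.exp_log (pow_pos hm0 (15 * d)), Real.log_pow]
    push_cast
    rfl
  rw [hexp]
  calc 2 * (96 * (d : ℝ) ^ 3 * (2 * d) ^ (2 * d))
      ≤ 2 ^ 8 * (d : ℝ) ^ 3 * (2 * d) ^ (2 * d) := by
        have : (0 : ℝ) ≤ (d : ℝ) ^ 3 * (2 * d) ^ (2 * d) := by positivity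
        nlinarith
    _ ≤ m ^ 8 * m ^ 3 * (m * m) ^ (2 * d) := by gcongr
    _ = m ^ (11 + 4 * d) := by ring
    _ ≤ m ^ (15 * d) := pow_le_pow_right₀ (by linarith) (by omega)

theorem theorem4p2 :
    ∃ C : ℝ, 0 < C ∧ ∀ d : ℕ, 1 ≤ d →
      ∀ (T : ℕ) (w : Euc d) (p v : ℕ → Euc d), IsJohnRun T w p v →
        -- the algorithm can always go on: there is a next query, and it lies in the unit ball
        (∃ E c, IsJohnEllipsoid (knowledgeSet p v T) E c) ∧
        (∀ E c, IsJohnEllipsoid (knowledgeSet p v T) E c → c ∈ closedBall (0 : Euc d) 1) ∧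
        -- the regret bound; the maximum only matters for `d = 1`, where `d log d = 0`
        cuttingPlaneRegret T w p v ≤ Real.exp (C * d * Real.log (max (d : ℝ) 2)) :=
  ⟨15, by norm_num, fun _ hd T _ _ _ h =>
    ⟨exists_isJohnEllipsoid hd (convex_knowledgeSet T) (isCompact_knowledgeSet T)
      h.interior_knowledgeSet_nonempty,
    fun _ _ hE => knowledgeSet_subset_closedBall T hE.center_mem,
    (h.cuttingPlaneRegret_le hd).trans (two_mul_regret_constant_le_exp hd)⟩⟩
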